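/- **Theorem.** Let $k$ be an algebraically closed field of characteristic zero, let $X$ be a variety over $k$ (an integral separated scheme of finite type over $k$), and let $f \colon Y \to X$ be a resolution of singularities, that is, a proper birational morphism over $k$ from a smooth variety $Y$. Let $\mathrm{Ex}(f) = f^{-1}(Z)$ be the exceptional locus of $f$ with its reduced scheme structure, where $Z \subset X$ is the indeterminacy locus of $f^{-1}$ (the complement of the largest open subset of $X$ over which $f$ is an isomorphism). For a $k$-scheme $V$ let $V_\infty$ denote its space of arcs, i.e. the inverse limit of its jet schemes; it is glued from the affine schemes $U_\infty$, for $U = \mathrm{Spec}\, A$ an affine open subset of $V$, where $U_\infty$ is the spectrum of the $k$-algebra generated by the symbols $D_n a$ ($a \in A$, $n \ge 0$) modulo the relations $D_n(a+b) = D_n a + D_n b$, $D_n(ab) = \sum_{i+j=n} D_i a \, D_j b$, and $D_0 c = c$, $D_n c = 0$ ($n>0$) for $c \in k$. Let $f_\infty \colon Y_\infty \to X_\infty$ be the morphism $\alpha \mapsto f \circ \alpha$ induced by $f$, and regard $\mathrm{Ex}(f)_\infty$ as a subset of $Y_\infty$ via the morphism induced by the inclusion $\mathrm{Ex}(f) \hookrightarrow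 Y$. A subset of $X_\infty$ or $Y_\infty$ is constructible if it is a finite union of finite intersections of retrocompact open sets and their complements. Let $C \subset Y_\infty$ be a constructible set such that no irreducible component of the closure $\overline C$ is contained in $\mathrm{Ex}(f)_\infty$. Then there is a constructible set $D \subset X_\infty$ such that $$D \subset f_\infty(C) \subset \overline D .$$ -/

import Mathlib

open CategoryTheory CategoryTheory.Limits AlgebraicGeometry Topology

universe u

namespace ArcSpace

section HasseSchmidt

/-- The relations imposed on the symbols `X (a, n)`, standing for the Hasse-Schmidt derivative
`D_n a`, of elements of an `R`-algebra `φ : R →+* A`. -/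
inductive HSRel {R A : Type u} [CommRing R] [CommRing A] (φ : R →+* A) :
    MvPolynomial (A × ℕ) ℤ → Prop
  | one : HSRel φ (MvPolynomial.X (1, 0) - 1)
  | add (a b : A) (n : ℕ) : HSRel φ
      (MvPolynomial.X (a + b, n) - (MvPolynomial.X (a, n) + MvPolynomial.X (b, n)))
  | mul (a b : A) (n : ℕ) : HSRel φ
      (MvPolynomial.X (a * b, n) -
        ∑ ij ∈ Finset.HasAntidiagonal.antidiagonal n, MvPolynomial.X (a, ij.1) * MvPolynomial.X (b, ij.2))
  | const (r : R) (n : ℕ) : HSRel φ (MvPolynomial.X (φ r, n + 1))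

/-- The Hasse-Schmidt algebra of `φ : R →+* A`: the commutative ring generated by the symbols
`D_n a` (`a : A`, `n : ℕ`) subject to `D_n (a + b) = D_n a + D_n b`,
`D_n (a * b) = ∑_{i + j = n} D_i a * D_j b`, `D_0 1 = 1` and `D_n (φ r) = 0` for `n > 0`.
For a field `R`, its spectrum is the space of arcs of the affine `R`-scheme `Spec A`. -/
abbrev HS {R A : Type u} [CommRing R] [CommRing A] (φ : R →+* A) : Type u :=
  MvPolynomial (A × ℕ) ℤ ⧸ Ideal.span {p | HSRel φ p}

namespace HS

variable {R A B : Type u} [CommRing R] [CommRing A] [CommRing B] (φ : R →+* A)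

/-- The universal Hasse-Schmidt derivative `D_n : A → HS φ`. -/
noncomputable def D (n : ℕ) (a : A) : HS φ := Ideal.Quotient.mk _ (MvPolynomial.X (a, n))

lemma D_one : D φ 0 1 = 1 := by
  rw [D, ← map_one (Ideal.Quotient.mk _), Ideal.Quotient.eq]
  exact Ideal.subset_span .one

lemma D_add (n : ℕ) (a b : A) : D φ n (a + b) = D φ n a + D φ n b := by
  simp only [D, ← map_add]
  rw [Ideal.Quotient.eq]
  exact Ideal.subset_span (.add a b n)

lemma D_mul (n : ℕ) (a b : A) :
    D φ n (a * b) = ∑ ij ∈ Finset.HasAntidiagonal.antidiagonal n, D φ ij.1 a * D φ ij.2 b := by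
  simp only [D, ← map_mul, ← map_sum]
  rw [Ideal.Quotient.eq]
  exact Ideal.subset_span (.mul a b n)

lemma D_const (n : ℕ) (r : R) : D φ (n + 1) (φ r) = 0 := by
  rw [D, Ideal.Quotient.eq_zero_iff_mem]
  exact Ideal.subset_span (.const r n)

/-- The universal arc `a ↦ ∑ (D_n a) t ^ n`, a ring homomorphism `A →+* (HS φ)⟦t⟧`. -/
noncomputable def univ : A →+* PowerSeries (HS φ) where
  toFun a := PowerSeries.mk fun n ↦ D φ n a
  map_zero' := by
    ext n
    have := D_add φ n 0 0
    simpa using this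
  map_one' := by
    ext n
    rcases n with _ | n
    · simp [D_one]
    · have := D_const φ n 1
      simpa [PowerSeries.coeff_one] using this
  map_add' a b := by ext n; simp [D_add]
  map_mul' a b := by ext n; simp [D_mul, PowerSeries.coeff_mul]

@[simp] lemma coeff_univ (n : ℕ) (a : A) : PowerSeries.coeff n (univ φ a) = D φ n a := by
  simp [univ]

variable {φ} in
/-- Ring homomorphisms out of the Hasse-Schmidt algebra are determined by their values on the
derivatives. -/
lemma hom_ext {f g : HS φ →+* B} (h : ∀ n a, f (D φ n a) = g (D φ n a)) : f = g := by
  apply Ideal.Quotient.ringHom_ext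
  apply MvPolynomial.ringHom_ext
  · intro r; simp
  · rintro ⟨a, n⟩; exact h n a

/-- The universal property of the Hasse-Schmidt algebra: an arc `A →+* B⟦t⟧` which is constant on
the base ring induces a ring homomorphism `HS φ →+* B`. -/
noncomputable def lift (ψ : A →+* PowerSeries B)
    (hψ : ∀ r n, PowerSeries.coeff (n + 1) (ψ (φ r)) = 0) : HS φ →+* B :=
  Ideal.Quotient.lift _
    (MvPolynomial.eval₂Hom (Int.castRingHom B) fun p ↦ PowerSeries.coeff p.2 (ψ p.1)) <| by
    intro a ha
    rw [← RingHom.mem_ker]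
    revert a
    change Ideal.span _ ≤ _
    rw [Ideal.span_le]
    intro p hp
    simp only [SetLike.mem_coe, RingHom.mem_ker]
    induction hp with
    | one => simp
    | add a b n => simp
    | mul a b n => simp [PowerSeries.coeff_mul]
    | const r n => simp [hψ]

@[simp] lemma lift_D (ψ : A →+* PowerSeries B)
    (hψ : ∀ r n, PowerSeries.coeff (n + 1) (ψ (φ r)) = 0) (n : ℕ) (a : A) :
    lift φ ψ hψ (D φ n a) = PowerSeries.coeff n (ψ a) := by
  simp [lift, D]

/-- The inclusion `D_0` of `A` in its Hasse-Schmidt algebra. -/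
noncomputable def incl : A →+* HS φ := PowerSeries.constantCoeff.comp (univ φ)

@[simp] lemma incl_apply (a : A) : incl φ a = D φ 0 a := by
  simp [incl, ← PowerSeries.coeff_zero_eq_constantCoeff_apply]

variable {φ} {φ' : R →+* B}

/-- Functoriality of the Hasse-Schmidt algebra: `D_n a ↦ D_n (g a)`. -/
noncomputable def map (g : A →+* B) (hg : g.comp φ = φ') : HS φ →+* HS φ' :=
  lift φ ((univ φ').comp g) fun r n ↦ by
    subst hg
    exact (coeff_univ _ _ _).trans (D_const (g.comp φ) n r)

@[simp] lemma map_D (g : A →+* B) (hg : g.comp φ = φ') (n : ℕ) (a : A) :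
    map g hg (D φ n a) = D φ' n (g a) := by
  simp [map]

lemma map_comp_map {C : Type u} [CommRing C] {φ'' : R →+* C} (g : A →+* B) (hg : g.comp φ = φ')
    (g' : B →+* C) (hg' : g'.comp φ' = φ'') (g'' : A →+* C) (hg'' : g''.comp φ = φ'')
    (e : g'' = g'.comp g) : map g'' hg'' = (map g' hg').comp (map g hg) := by
  subst e
  apply hom_ext
  intro n a
  simp

/-- The formation of Hasse-Schmidt algebras commutes with localization. -/
lemma isLocalization_away (g : A →+* B) (hg : g.comp φ = φ') (f : A)
    (hf : letI := g.toAlgebra; IsLocalization.Away f B) :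
    letI := (map g hg).toAlgebra
    IsLocalization.Away (incl φ f) (HS φ') := by
  let := g.toAlgebra
  let := (map g hg).toAlgebra
  let L := Localization.Away (incl φ f)
  let ℓ : HS φ →+* L := algebraMap _ _
  -- the arc of `L` obtained by localization
  let ψ₀ : A →+* PowerSeries L := (PowerSeries.map ℓ).comp (univ φ)
  have hu : IsUnit (ψ₀ f) := by
    rw [PowerSeries.isUnit_iff_constantCoeff]
    have : PowerSeries.constantCoeff (ψ₀ f) = ℓ (incl φ f) := by
      simp [ψ₀, ← PowerSeries.coeff_zero_eq_constantCoeff_apply]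
    rw [this]
    exact IsLocalization.Away.algebraMap_isUnit _
  let ψ : B →+* PowerSeries L := IsLocalization.Away.lift f hu
  have hψ (a : A) : ψ (g a) = ψ₀ a := IsLocalization.Away.lift_eq f hu a
  let inv : HS φ' →+* L := lift φ' ψ fun r n ↦ by
    subst hg
    simp only [RingHom.comp_apply, hψ]
    simp [ψ₀, D_const]
  have hu' : IsUnit (map g hg (incl φ f)) := by
    rw [incl_apply, map_D, ← incl_apply]
    exact (IsLocalization.Away.algebraMap_isUnit (S := B) f).map (incl φ')
  let fwd : L →+* HS φ' := IsLocalization.Away.lift (incl φ f) hu'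
  have hfwd (x) : fwd (ℓ x) = map g hg x := IsLocalization.Away.lift_eq (incl φ f) hu' x
  have h1 : inv.comp (map g hg) = ℓ := by
    apply hom_ext
    intro n a
    simp [inv, hψ, ψ₀]
  have h2 : inv.comp fwd = RingHom.id L := by
    apply IsLocalization.ringHom_ext (Submonoid.powers (incl φ f))
    refine RingHom.ext fun x ↦ ?_
    change inv (fwd (ℓ x)) = ℓ x
    rw [hfwd]
    exact congr($h1 x)
  have h3 : (PowerSeries.map fwd).comp ψ = univ φ' := by
    apply IsLocalization.ringHom_ext (Submonoid.powers f)
    refine RingHom.ext fun a ↦ ?_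
    change PowerSeries.map fwd (ψ (g a)) = univ φ' (g a)
    rw [hψ]
    ext n
    simp [ψ₀, hfwd]
  have h4 : fwd.comp inv = RingHom.id _ := by
    apply hom_ext
    intro n b
    have := congr(PowerSeries.coeff n ($h3 b))
    simpa [inv] using this
  let e : L ≃ₐ[HS φ] HS φ' :=
    { RingEquiv.ofRingHom fwd inv h4 h2 with
      commutes' := fun x ↦ hfwd x }
  exact IsLocalization.isLocalization_of_algEquiv _ e

end HS

end HasseSchmidt
section Scheme

variable {k : Type u} [CommRing k]

/-- The `k`-algebra structure on the sections of a `k`-scheme. -/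
noncomputable def baseHom (X : Over (Spec (CommRingCat.of k))) (U : X.left.Opens) :
    k →+* Γ(X.left, U) :=
  ((Scheme.ΓSpecIso (CommRingCat.of k)).inv ≫ X.hom.appLE ⊤ U le_top).hom

lemma map_comp_baseHom (X : Over (Spec (CommRingCat.of k))) {U V : X.left.Opens} (h : U ≤ V) :
    (X.left.presheaf.map (homOfLE h).op).hom.comp (baseHom X V) = baseHom X U := by
  have : X.hom.appLE ⊤ V le_top ≫ X.left.presheaf.map (homOfLE h).op = X.hom.appLE ⊤ U le_top :=
    Scheme.Hom.appLE_map ..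
  rw [baseHom, baseHom, ← this]
  rfl

lemma appLE_comp_baseHom {X Y : Over (Spec (CommRingCat.of k))} (f : Y ⟶ X)
    {U : X.left.Opens} {V : Y.left.Opens} (h : V ≤ f.left ⁻¹ᵁ U) :
    (f.left.appLE U V h).hom.comp (baseHom X U) = baseHom Y V := by
  have h1 : X.hom.appLE ⊤ U le_top ≫ f.left.appLE U V h = (f.left ≫ X.hom).appLE ⊤ V le_top :=
    Scheme.Hom.appLE_comp_appLE ..
  have h2 : (f.left ≫ X.hom).appLE ⊤ V le_top = Y.hom.appLE ⊤ V le_top := by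
    congr 1
    exact Over.w f
  rw [baseHom, baseHom, ← h2, ← h1]
  rfl

/-- The presheaf of Hasse-Schmidt algebras on a `k`-scheme. -/
noncomputable def hsPresheaf (X : Over (Spec (CommRingCat.of k))) :
    X.left.Opensᵒᵖ ⥤ CommRingCat.{u} where
  obj U := CommRingCat.of (HS (baseHom X U.unop))
  map {U V} i := CommRingCat.ofHom
    (HS.map (X.left.presheaf.map i).hom (map_comp_baseHom X i.unop.le))
  map_id U := by
    ext1
    apply HS.hom_ext
    intro n a
    simp
  map_comp {U V W} i j := by
    ext1
    exact HS.map_comp_map _ (map_comp_baseHom X i.unop.le) _ (map_comp_baseHom X j.unop.le) _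
      (map_comp_baseHom X (i ≫ j).unop.le) congr($(X.left.presheaf.map_comp i j).hom)

/-- The inclusion `D_0` of the structure sheaf in the presheaf of Hasse-Schmidt algebras. -/
noncomputable def hsIncl (X : Over (Spec (CommRingCat.of k))) :
    X.left.presheaf ⟶ hsPresheaf X where
  app U := CommRingCat.ofHom (HS.incl (baseHom X U.unop))
  naturality {U V} i := by
    ext a
    refine (HS.incl_apply _ _).trans ?_
    refine .trans (HS.map_D _ (map_comp_baseHom X i.unop.le) 0 a).symm ?_
    exact congr(HS.map (X.left.presheaf.map i).hom (map_comp_baseHom X i.unop.le)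
      $((HS.incl_apply _ _).symm))

lemma hsIncl_coequifibered (X : Over (Spec (CommRingCat.of k))) :
    (Functor.whiskerLeft (Scheme.AffineZariskiSite.toOpensFunctor X.left).op
      (hsIncl X)).Coequifibered := by
  refine Scheme.AffineZariskiSite.coequifibered_iff_forall_isLocalizationAway.mpr fun U r ↦ ?_
  exact HS.isLocalization_away (φ := baseHom X U.1) (φ' := baseHom X (X.left.basicOpen r))
    (X.left.presheaf.map (homOfLE (X.left.basicOpen_le r)).op).hom (map_comp_baseHom X _) r
    (U.2.isLocalization_basicOpen r)

/-- The gluing data for the space of arcs: the affine schemes `Spec (HS Γ(X, U))`, where `U` runs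
over the affine open subsets of `X`. -/
noncomputable def glueData (X : Over (Spec (CommRingCat.of k))) :
    (Scheme.AffineZariskiSite.directedCover X.left).RelativeGluingData :=
  Scheme.AffineZariskiSite.relativeGluingData (hsIncl_coequifibered X)

instance (X : Over (Spec (CommRingCat.of k))) :
    ((glueData X).functor ⋙ Scheme.forget).IsLocallyDirected :=
  Scheme.Cover.RelativeGluingData.instIsLocallyDirectedI₀CompFunctorForgetOfIsThin ..

/-- The space of arcs `X_∞` of a `k`-scheme `X`, glued from the affine schemes
`(U)_∞ = Spec (HS Γ(X, U))`, where `U` runs over the affine open subsets of `X`. -/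
noncomputable def arcs (X : Over (Spec (CommRingCat.of k))) : Scheme.{u} := (glueData X).glued

/-- The projection `π_X : X_∞ ⟶ X` mapping an arc to its starting point. -/
noncomputable def arcsProj (X : Over (Spec (CommRingCat.of k))) : arcs X ⟶ X.left :=
  (glueData X).toBase

/-- The open subscheme `U_∞ = Spec (HS Γ(X, U))` of `X_∞`, for `U ⊆ X` an affine open subset. -/
noncomputable def arcsChart (X : Over (Spec (CommRingCat.of k))) (U : X.left.AffineZariskiSite) :
    Spec (CommRingCat.of (HS (baseHom X U.1))) ⟶ arcs X :=
  (glueData X).cover.f U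

instance (X : Over (Spec (CommRingCat.of k))) (U : X.left.AffineZariskiSite) :
    IsOpenImmersion (arcsChart X U) :=
  (glueData X).cover.map_prop U

lemma opensRange_arcsChart (X : Over (Spec (CommRingCat.of k))) (U : X.left.AffineZariskiSite) :
    (arcsChart X U).opensRange = arcsProj X ⁻¹ᵁ U.1 := by
  have := (glueData X).toBase_preimage_eq_opensRange_ι U
  simpa using! this.symm

/-- Charts are compatible with restriction to basic open subsets. -/
lemma map_arcsChart (X : Over (Spec (CommRingCat.of k))) {U V : X.left.AffineZariskiSite}
    (h : U ≤ V) :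
    Spec.map (CommRingCat.ofHom (HS.map (X.left.presheaf.map
      (homOfLE (Scheme.AffineZariskiSite.toOpens_mono h)).op).hom (map_comp_baseHom X _))) ≫
      arcsChart X V = arcsChart X U :=
  colimit.w (glueData X).functor (homOfLE h)

/-- The morphism `V_∞ ⟶ X_∞` induced by `f : Y ⟶ X` for affine opens `V ⊆ Y` and `U ⊆ X` with
`f(V) ⊆ U`. -/
noncomputable def chartMap {X Y : Over (Spec (CommRingCat.of k))} (f : Y ⟶ X)
    (U : X.left.AffineZariskiSite) (V : Y.left.AffineZariskiSite) (h : V.1 ≤ f.left ⁻¹ᵁ U.1) :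
    Spec (CommRingCat.of (HS (baseHom Y V.1))) ⟶ arcs X :=
  Spec.map (CommRingCat.ofHom (HS.map (f.left.appLE U.1 V.1 h).hom (appLE_comp_baseHom f h))) ≫
    arcsChart X U

lemma chartMap_eq {X Y : Over (Spec (CommRingCat.of k))} (f : Y ⟶ X)
    {U U' : X.left.AffineZariskiSite} {V V' : Y.left.AffineZariskiSite}
    (h : V.1 ≤ f.left ⁻¹ᵁ U.1) (h' : V'.1 ≤ f.left ⁻¹ᵁ U'.1) (hU : U' ≤ U) (hV : V' ≤ V) :
    Spec.map (CommRingCat.ofHom (HS.map (Y.left.presheaf.map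
      (homOfLE (Scheme.AffineZariskiSite.toOpens_mono hV)).op).hom (map_comp_baseHom Y _))) ≫
      chartMap f U V h = chartMap f U' V' h' := by
  simp only [chartMap]
  rw [← map_arcsChart X hU, ← Category.assoc, ← Category.assoc, ← Spec.map_comp, ← Spec.map_comp]
  congr 2
  ext1
  apply HS.hom_ext
  intro n a
  simp only [CommRingCat.hom_comp, CommRingCat.hom_ofHom, RingHom.comp_apply, HS.map_D]
  congr 1
  simp only [← RingHom.comp_apply, ← CommRingCat.hom_comp, Scheme.Hom.appLE_map,
    Scheme.Hom.map_appLE]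

lemma mem_arcsChart_iff (X : Over (Spec (CommRingCat.of k))) (U : X.left.AffineZariskiSite)
    (x : arcs X) : x ∈ Set.range (arcsChart X U) ↔ arcsProj X x ∈ U.1 := by
  have := congr(x ∈ $(opensRange_arcsChart X U))
  simpa using! this

/-- Given affine opens `V i ⊆ Y` mapping into affine opens `U i ⊆ X`, `i = 1, 2`, each point of
`V 1 ∩ V 2` has a smaller pair of neighbourhoods that are basic open in the given ones. -/
lemma exists_smaller {X Y : Over (Spec (CommRingCat.of k))} (f : Y ⟶ X)
    {U₁ U₂ : X.left.AffineZariskiSite} {V₁ V₂ : Y.left.AffineZariskiSite}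
    (h₁ : V₁.1 ≤ f.left ⁻¹ᵁ U₁.1) (h₂ : V₂.1 ≤ f.left ⁻¹ᵁ U₂.1) (y : Y.left)
    (hy₁ : y ∈ V₁.1) (hy₂ : y ∈ V₂.1) :
    ∃ (U : X.left.AffineZariskiSite) (V : Y.left.AffineZariskiSite),
      V.1 ≤ f.left ⁻¹ᵁ U.1 ∧ y ∈ V.1 ∧ U ≤ U₁ ∧ U ≤ U₂ ∧ V ≤ V₁ ∧ V ≤ V₂ := by
  obtain ⟨a, b, hab, hya⟩ := exists_basicOpen_le_affine_inter U₁.2 U₂.2 (f.left y)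
    ⟨h₁ hy₁, h₂ hy₂⟩
  let a' := f.left.appLE _ _ h₁ a
  let b' := f.left.appLE _ _ h₂ b
  have ha' : Y.left.basicOpen a' = V₁.1 ⊓ f.left ⁻¹ᵁ X.left.basicOpen a := by
    simp [a', Scheme.Hom.appLE, Scheme.preimage_basicOpen]
  have hb' : Y.left.basicOpen b' = V₂.1 ⊓ f.left ⁻¹ᵁ X.left.basicOpen b := by
    simp [b', Scheme.Hom.appLE, Scheme.preimage_basicOpen]
  obtain ⟨c, d, hcd, hyc⟩ := exists_basicOpen_le_affine_inter (V₁.2.basicOpen a')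
    (V₂.2.basicOpen b') y ⟨by rw [ha']; exact ⟨hy₁, hya⟩, by
      rw [hb']; exact ⟨hy₂, by rw [← hab]; exact hya⟩⟩
  refine ⟨U₁.basicOpen a, (V₁.basicOpen a').basicOpen c, ?_, hyc, U₁.basicOpen_le a, ?_,
    ((V₁.basicOpen a').basicOpen_le c).trans (V₁.basicOpen_le a'), ?_⟩
  · refine (Y.left.basicOpen_le c).trans ?_
    rw [ha']
    exact inf_le_right
  · rw [show U₁.basicOpen a = U₂.basicOpen b from Subtype.ext hab]
    exact U₂.basicOpen_le b
  · rw [show (V₁.basicOpen a').basicOpen c = (V₂.basicOpen b').basicOpen d from Subtype.ext hcd]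
    exact ((V₂.basicOpen b').basicOpen_le d).trans (V₂.basicOpen_le b')

lemma chartMap_compat {X Y : Over (Spec (CommRingCat.of k))} (f : Y ⟶ X)
    {U₁ U₂ : X.left.AffineZariskiSite} {V₁ V₂ : Y.left.AffineZariskiSite}
    (h₁ : V₁.1 ≤ f.left ⁻¹ᵁ U₁.1) (h₂ : V₂.1 ≤ f.left ⁻¹ᵁ U₂.1) {T : Scheme.{u}}
    (p₁ : T ⟶ Spec (CommRingCat.of (HS (baseHom Y V₁.1))))
    (p₂ : T ⟶ Spec (CommRingCat.of (HS (baseHom Y V₂.1))))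
    (hp : p₁ ≫ arcsChart Y V₁ = p₂ ≫ arcsChart Y V₂) :
    p₁ ≫ chartMap f U₁ V₁ h₁ = p₂ ≫ chartMap f U₂ V₂ h₂ := by
  apply Scheme.hom_ext_of_forall
  intro z
  have hz₁ : arcsProj Y ((p₁ ≫ arcsChart Y V₁) z) ∈ V₁.1 :=
    (mem_arcsChart_iff Y V₁ _).mp ⟨p₁ z, by simp⟩
  have hz₂ : arcsProj Y ((p₁ ≫ arcsChart Y V₁) z) ∈ V₂.1 :=
    (mem_arcsChart_iff Y V₂ _).mp ⟨p₂ z, by rw [hp]; simp⟩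
  obtain ⟨U, V, h, hzV, hU₁, hU₂, hV₁, hV₂⟩ := exists_smaller f h₁ h₂ _ hz₁ hz₂
  refine ⟨(p₁ ≫ arcsChart Y V₁) ⁻¹ᵁ (arcsChart Y V).opensRange,
    (mem_arcsChart_iff Y V _).mpr hzV, ?_⟩
  set W := (p₁ ≫ arcsChart Y V₁) ⁻¹ᵁ (arcsChart Y V).opensRange
  have hW : Set.range (W.ι ≫ p₁ ≫ arcsChart Y V₁) ⊆ Set.range (arcsChart Y V) := by
    rintro _ ⟨w, rfl⟩
    exact w.2
  let q := IsOpenImmersion.lift (arcsChart Y V) (W.ι ≫ p₁ ≫ arcsChart Y V₁) hW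
  have hq : q ≫ arcsChart Y V = W.ι ≫ p₁ ≫ arcsChart Y V₁ := IsOpenImmersion.lift_fac ..
  rw [← map_arcsChart Y hV₁, ← Category.assoc, ← Category.assoc, cancel_mono] at hq
  have hq' : q ≫ arcsChart Y V = W.ι ≫ p₂ ≫ arcsChart Y V₂ := by
    rw [← hp]; exact IsOpenImmersion.lift_fac ..
  rw [← map_arcsChart Y hV₂, ← Category.assoc, ← Category.assoc, cancel_mono] at hq'
  rw [← Category.assoc, ← Category.assoc, ← hq, ← hq', Category.assoc, Category.assoc,
    chartMap_eq f h₁ h hU₁ hV₁, chartMap_eq f h₂ h hU₂ hV₂]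

/-- The pairs of affine open subsets `V ⊆ Y`, `U ⊆ X` with `f(V) ⊆ U`. -/
abbrev ChartPair {X Y : Over (Spec (CommRingCat.of k))} (f : Y ⟶ X) : Type u :=
  {p : X.left.AffineZariskiSite × Y.left.AffineZariskiSite // p.2.1 ≤ f.left ⁻¹ᵁ p.1.1}

/-- The open cover of `Y_∞` by the `V_∞`, where `V` runs over the affine open subsets of `Y` that
map into an affine open subset of `X`. -/
noncomputable def pairCover {X Y : Over (Spec (CommRingCat.of k))} (f : Y ⟶ X) :
    (arcs Y).OpenCover where
  I₀ := ChartPair f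
  X p := Spec (CommRingCat.of (HS (baseHom Y p.1.2.1)))
  f p := arcsChart Y p.1.2
  mem₀ := by
    rw [Scheme.presieve₀_mem_precoverage_iff]
    refine ⟨fun y ↦ ?_, inferInstance⟩
    obtain ⟨_, ⟨U, hU, rfl⟩, hyU, -⟩ := X.left.isBasis_affineOpens.exists_subset_of_mem_open
      (Set.mem_univ (f.left (arcsProj Y y))) isOpen_univ
    obtain ⟨_, ⟨V, hV, rfl⟩, hyV, hVU⟩ := Y.left.isBasis_affineOpens.exists_subset_of_mem_open
      (show arcsProj Y y ∈ f.left ⁻¹ᵁ U from hyU) (f.left ⁻¹ᵁ U).2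
    exact ⟨⟨(⟨U, hU⟩, ⟨V, hV⟩), hVU⟩, (mem_arcsChart_iff Y ⟨V, hV⟩ y).mpr hyV⟩

/-- The morphism `f_∞ : Y_∞ ⟶ X_∞` induced by a morphism `f : Y ⟶ X` of `k`-schemes, mapping an
arc `α` to `f ∘ α`. On charts it is induced by `D_n a ↦ D_n (f^* a)`, see `arcsChart_arcsMap`. -/
noncomputable def arcsMap {X Y : Over (Spec (CommRingCat.of k))} (f : Y ⟶ X) : arcs Y ⟶ arcs X :=
  (pairCover f).glueMorphisms (fun p ↦ chartMap f p.1.1 p.1.2 p.2)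
    fun p q ↦ chartMap_compat f p.2 q.2 _ _ pullback.condition

lemma arcsChart_arcsMap {X Y : Over (Spec (CommRingCat.of k))} (f : Y ⟶ X)
    (U : X.left.AffineZariskiSite) (V : Y.left.AffineZariskiSite) (h : V.1 ≤ f.left ⁻¹ᵁ U.1) :
    arcsChart Y V ≫ arcsMap f = Spec.map (CommRingCat.ofHom
      (HS.map (f.left.appLE U.1 V.1 h).hom (appLE_comp_baseHom f h))) ≫ arcsChart X U :=
  (pairCover f).ι_glueMorphisms _ _ ⟨(U, V), h⟩

/-- A variety over `k`: an integral separated scheme of finite type over `k`. -/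
structure IsVariety (X : Over (Spec (CommRingCat.of k))) : Prop where
  isIntegral : AlgebraicGeometry.IsIntegral X.left
  isSeparated : IsSeparated X.hom
  locallyOfFiniteType : LocallyOfFiniteType X.hom
  quasiCompact : QuasiCompact X.hom

/-- A resolution of singularities of `X`: a proper birational morphism from a smooth variety. -/
structure IsResolution {X Y : Over (Spec (CommRingCat.of k))} (f : Y ⟶ X) : Prop where
  isVariety : IsVariety Y
  smooth : Smooth Y.hom
  proper : IsProper f.left
  birational : ∃ U : X.left.Opens, Dense (U : Set X.left) ∧ IsIso (f.left ∣_ U)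

/-- The largest open subset of the target over which `f` is an isomorphism. For a proper birational
morphism of varieties, this is the domain of definition of the rational map `f⁻¹`. -/
def isoLocus {X Y : Scheme.{u}} (f : Y ⟶ X) : X.Opens := sSup {U | IsIso (f ∣_ U)}

/-- The exceptional locus `Ex(f) = f⁻¹(Z)`, where `Z` is the indeterminacy locus of `f⁻¹`. -/
def exceptionalLocus {X Y : Scheme.{u}} (f : Y ⟶ X) : TopologicalSpace.Closeds Y :=
  (f ⁻¹ᵁ isoLocus f).compl

/-- The exceptional locus with its reduced scheme structure. -/
noncomputable def exceptionalScheme {X Y : Over (Spec (CommRingCat.of k))} (f : Y ⟶ X) :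
    Over (Spec (CommRingCat.of k)) :=
  Over.mk ((Scheme.IdealSheafData.vanishingIdeal (exceptionalLocus f.left)).subschemeι ≫ Y.hom)

/-- The closed immersion `Ex(f) ⟶ Y`. -/
noncomputable def exceptionalι {X Y : Over (Spec (CommRingCat.of k))} (f : Y ⟶ X) :
    exceptionalScheme f ⟶ Y :=
  Over.homMk (Scheme.IdealSheafData.vanishingIdeal (exceptionalLocus f.left)).subschemeι rfl

/-- The arc space of the exceptional locus, as a subset of `Y_∞`. -/
def exceptionalArcs {X Y : Over (Spec (CommRingCat.of k))} (f : Y ⟶ X) : Set (arcs Y) :=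
  Set.range (arcsMap (exceptionalι f))

end Scheme

end ArcSpace

/-!
The argument rests on two facts.

*Generic points.* If `B` is étale over a polynomial ring `k[x_i]`, then an arc of `Spec B` is the
same as its starting point together with arbitrary values of the `D_n x_i`, `n > 0`, so the
Hasse-Schmidt algebra of `B` is a polynomial ring over `B` in infinitely many variables
(`nonempty_ringEquiv_HS`). Over a noetherian ring such a polynomial ring behaves like a noetherian
one as far as finitely generated ideals are concerned: they have finitely many minimal primes. Hence
a constructible set `C` of arcs of the smooth variety `Y` has a finite subset whose closure contains
`C` (`exists_finite_generic_arcs`), and every irreducible component of the closure of `C` is in the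
closure of one point `η` of this subset. It is therefore enough to find, for each such `η` not in
`Ex(f)_∞`, a constructible set `D` with `f_∞(η) ∈ D ⊆ f_∞(C)`: then `f_∞` maps the closure of `η` to
the closure of `D`.

*Lifting arcs.* The generic point of the arc `η` lies where `f` is an isomorphism. So there are
affine charts `Spec B ⊆ Y` and `Spec A ⊆ X` and `g ∈ A` with `A_g = B_g` such that `g` does not
vanish identically along `η`; let `e` be its order. Let `b_i = a_i / g ^ n_i` be generators of `B`.
An arc of `Spec A` along which `g` has order `e` lifts to `Spec B` if and only if each `a_i` has
order at least `e * n_i` along it, and the lift is unique. These are finitely many conditions on the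
arc, so the arcs of `Spec B` along which `g` has order `e` form a scheme which is of finite
presentation over the arcs of `Spec A`, and Chevalley's theorem shows that the image of its
intersection with `C` is constructible (`exists_isConstructible_HS`).
-/

namespace ArcSpace

/-! ### Constructible subsets of spectra of polynomial rings -/

lemma isConstructible_comap_preimage {R S : Type*} [CommRing R] [CommRing S] (f : R →+* S)
    {C : Set (PrimeSpectrum R)} (hC : IsConstructible C) :
    IsConstructible (PrimeSpectrum.comap f ⁻¹' C) := by
  obtain ⟨d, rfl⟩ := PrimeSpectrum.exists_constructibleSetData_iff.mpr hC
  rw [← PrimeSpectrum.ConstructibleSetData.toSet_map]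
  exact PrimeSpectrum.ConstructibleSetData.isConstructible_toSet _

lemma isPrime_map_mvPolynomial_C {R σ : Type*} [CommRing R] (P : Ideal R) [P.IsPrime] :
    (P.map (MvPolynomial.C : R →+* MvPolynomial σ R)).IsPrime := by
  rw [← Ideal.Quotient.isDomain_iff_prime]
  exact (MvPolynomial.quotientEquivQuotientMvPolynomial (σ := σ) P).symm.toMulEquiv.isDomain _

/-- If `h : N → M` extends prime ideals to prime ideals, then the minimal primes of an extended
ideal are extended from minimal primes; there are finitely many if `N` is noetherian. -/
lemma finite_minimalPrimes_map {N M : Type*} [CommRing N] [CommRing M] [IsNoetherianRing N]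
    (h : N →+* M) (hp : ∀ P : Ideal N, P.IsPrime → (P.map h).IsPrime) (I : Ideal N) :
    (I.map h).minimalPrimes.Finite := by
  refine ((I.finite_minimalPrimes_of_isNoetherianRing).image (Ideal.map h)).subset fun q hq ↦ ?_
  have hqp : q.IsPrime := hq.1.1
  obtain ⟨p, hpI, hpq⟩ := Ideal.exists_minimalPrimes_le (Ideal.map_le_iff_le_comap.mp hq.1.2)
  have hle : p.map h ≤ q := Ideal.map_le_iff_le_comap.mpr hpq
  exact ⟨p, hpI, le_antisymm hle (hq.2 ⟨hp p hpI.1.1, Ideal.map_mono hpI.1.2⟩ hle)⟩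

/-- Only finitely many variables occur in the generators of a finitely generated ideal, and
adjoining the other ones extends prime ideals to prime ideals. -/
lemma finite_minimalPrimes_mvPolynomial {B σ : Type*} [CommRing B] [IsNoetherianRing B]
    (I : Ideal (MvPolynomial σ B)) (hI : I.FG) : I.minimalPrimes.Finite := by
  classical
  obtain ⟨G, rfl⟩ := hI
  let s : Set σ := (G.biUnion MvPolynomial.vars : Finset σ)
  have : Finite s := Finset.finite_toSet _
  let e : MvPolynomial (↥sᶜ) (MvPolynomial s B) ≃+* MvPolynomial σ B :=
    ((MvPolynomial.sumAlgEquiv B (↥sᶜ) s).symm.trans (MvPolynomial.renameEquiv B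
      ((Equiv.sumComm _ _).trans (Equiv.Set.sumCompl s)))).toRingEquiv
  have he (p : MvPolynomial s B) : e (MvPolynomial.C p) = MvPolynomial.rename Subtype.val p := by
    change (e.toRingHom.comp MvPolynomial.C) p = (MvPolynomial.rename Subtype.val).toRingHom p
    congr 1
    apply MvPolynomial.ringHom_ext
    · intro b; simp [e]
    · intro i; simp [e]
  let h : MvPolynomial s B →+* MvPolynomial σ B := e.toRingHom.comp MvPolynomial.C
  have hG : ∃ I₀ : Ideal (MvPolynomial s B), I₀.map h = Ideal.span (G : Set (MvPolynomial σ B)) := by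
    refine ⟨(Ideal.span (h ⁻¹' G)), ?_⟩
    rw [Ideal.map_span, Set.image_preimage_eq_of_subset]
    intro p hp
    obtain ⟨q, rfl⟩ := MvPolynomial.exists_rename_eq_of_vars_subset_range p
      (Subtype.val : s → σ) Subtype.val_injective (by
        rw [Subtype.range_val]
        exact_mod_cast Finset.subset_biUnion_of_mem MvPolynomial.vars hp)
    exact ⟨q, he q⟩
  obtain ⟨I₀, hI₀⟩ := hG
  rw [← hI₀]
  refine finite_minimalPrimes_map h (fun P hP ↦ ?_) I₀
  have := isPrime_map_mvPolynomial_C (σ := ↥sᶜ) P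
  rw [← Ideal.map_map]
  exact Ideal.map_isPrime_of_equiv e

/-- If finitely generated ideals have finitely many minimal primes, every constructible set has
finitely many generic points. -/
lemma exists_finite_generic_of_isConstructible {M : Type*} [CommRing M]
    (hM : ∀ I : Ideal M, I.FG → I.minimalPrimes.Finite)
    {C : Set (PrimeSpectrum M)} (hC : IsConstructible C) :
    ∃ F : Set (PrimeSpectrum M), F.Finite ∧ F ⊆ C ∧ ∀ q ∈ C, ∃ p ∈ F, p ⤳ q := by
  obtain ⟨d, rfl⟩ := PrimeSpectrum.exists_constructibleSetData_iff.mpr hC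
  let I (c : PrimeSpectrum.BasicConstructibleSetData M) : Ideal M := Ideal.span (Set.range c.g)
  let F (c : PrimeSpectrum.BasicConstructibleSetData M) : Set (PrimeSpectrum M) :=
    c.toSet ∩ {p | p.asIdeal ∈ (I c).minimalPrimes}
  refine ⟨⋃ c ∈ d, F c, d.finite_toSet.biUnion fun c _ ↦ ?_, ?_, fun q hq ↦ ?_⟩
  · refine Set.Finite.subset ?_ Set.inter_subset_right
    refine ((hM (I c) (Submodule.fg_span (Set.finite_range _)))).preimage ?_
    exact fun p _ q _ h ↦ PrimeSpectrum.ext h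
  · exact Set.biUnion_mono subset_rfl fun c _ ↦ Set.inter_subset_left
  · obtain ⟨c, hc, hqc⟩ := Set.mem_iUnion₂.mp hq
    obtain ⟨p, hp, hpq⟩ := Ideal.exists_minimalPrimes_le (I := I c) (J := q.asIdeal)
      (Ideal.span_le.mpr hqc.1)
    refine ⟨⟨p, hp.1.1⟩, Set.mem_biUnion hc ⟨⟨?_, ?_⟩, hp⟩, ?_⟩
    · exact (PrimeSpectrum.mem_zeroLocus _ _).mpr (Ideal.span_le.mp hp.1.2)
    · exact fun h ↦ hqc.2 (Set.Subset.trans h hpq)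
    · exact (PrimeSpectrum.le_iff_specializes _ _).mp hpq

/-! ### The arcs of an étale algebra over a polynomial ring -/

section Etale

open PowerSeries

/-- An arc of the source of a formally unramified morphism is determined by its starting point and
its image in the target. -/
lemma arc_ext {S B T : Type*} [CommRing S] [CommRing B] [CommRing T] {g : S →+* B}
    (hg : g.FormallyUnramified) {ψ₁ ψ₂ : B →+* T⟦X⟧} (h : ψ₁.comp g = ψ₂.comp g)
    (h₀ : ∀ b, constantCoeff (ψ₁ b) = constantCoeff (ψ₂ b)) : ψ₁ = ψ₂ := by
  let := g.toAlgebra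
  let := (ψ₁.comp g).toAlgebra
  have : Algebra.FormallyUnramified S B := hg
  let a₁ : B →ₐ[S] T⟦X⟧ := { ψ₁ with commutes' := fun _ ↦ rfl }
  let a₂ : B →ₐ[S] T⟦X⟧ := { ψ₂ with commutes' := fun s ↦ congr($h.symm s) }
  have key : a₁ = a₂ := by
    refine Algebra.FormallyUnramified.ext_of_iInf (Ideal.span {(X : T⟦X⟧)}) ?_ fun b ↦ ?_
    · have : IsHausdorff (Ideal.span {(X : T⟦X⟧)}) T⟦X⟧ := inferInstance
      simpa using this.iInf_pow_smul
    · rw [Ideal.Quotient.eq, Ideal.mem_span_singleton, X_dvd_iff, map_sub, sub_eq_zero]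
      exact h₀ b
  exact congr(($key : B →+* T⟦X⟧))

/-- Arcs lift along formally smooth morphisms, with a given starting point. -/
lemma exists_arc_lift {S B T : Type*} [CommRing S] [CommRing B] [CommRing T] {g : S →+* B}
    (hg : g.FormallySmooth) (θ : S →+* T⟦X⟧) (β : B →+* T)
    (h : ∀ s, constantCoeff (θ s) = β (g s)) :
    ∃ ψ : B →+* T⟦X⟧, ψ.comp g = θ ∧ ∀ b, constantCoeff (ψ b) = β b := by
  let := g.toAlgebra
  let := θ.toAlgebra
  have : Algebra.FormallySmooth S B := hg
  let I : Ideal T⟦X⟧ := Ideal.span {X}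
  let f : B →ₐ[S] T⟦X⟧ ⧸ I :=
    { (Ideal.Quotient.mk I).comp (C.comp β) with
      commutes' := fun s ↦ by
        change Ideal.Quotient.mk I (C (β (g s))) = Ideal.Quotient.mk I (θ s)
        rw [Ideal.Quotient.eq, Ideal.mem_span_singleton, X_dvd_iff, map_sub, h]
        simp }
  obtain ⟨ψ, hψ⟩ := Algebra.FormallySmooth.exists_mkₐ_comp_eq_of_isAdicComplete f
  refine ⟨ψ.toRingHom, RingHom.ext fun s ↦ ψ.commutes s, fun b ↦ ?_⟩
  have : Ideal.Quotient.mk I (ψ b) = Ideal.Quotient.mk I (C (β b)) := congr($hψ b)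
  rw [Ideal.Quotient.eq, Ideal.mem_span_singleton, X_dvd_iff, map_sub, sub_eq_zero] at this
  simpa using this

variable {k B : Type u} [CommRing k] [CommRing B]

/-- If `B` is étale over a polynomial ring `k[x_i]`, then its Hasse-Schmidt algebra is the
polynomial ring over `B` in the variables `D_{n+1} x_i`. -/
theorem nonempty_ringEquiv_HS {ι : Type} {φ : k →+* B} (g : MvPolynomial ι k →+* B)
    (hgφ : g.comp MvPolynomial.C = φ) (hg : g.Etale) :
    Nonempty (HS φ ≃+* MvPolynomial (ι × ℕ) B) := by
  have hs : g.FormallySmooth := by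
    let := g.toAlgebra
    have : Algebra.Etale (MvPolynomial ι k) B := hg
    exact RingHom.formallySmooth_algebraMap.mpr inferInstance
  let M := MvPolynomial (ι × ℕ) B
  let x (i : ι) : M⟦X⟧ := PowerSeries.mk fun n ↦
    n.casesOn (MvPolynomial.C (g (.X i))) fun n ↦ MvPolynomial.X (i, n)
  let θ : MvPolynomial ι k →+* M⟦X⟧ :=
    MvPolynomial.eval₂Hom ((PowerSeries.C.comp MvPolynomial.C).comp φ) x
  have hC (r : k) : g (.C r) = φ r := congr($hgφ r)
  obtain ⟨ψ, hψg, hψ₀⟩ := exists_arc_lift hs θ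
    (MvPolynomial.C : B →+* M) (by
      intro s
      change (constantCoeff.comp θ) s = (MvPolynomial.C.comp g) s
      congr 1
      apply MvPolynomial.ringHom_ext
      · intro r; simp [θ, hC]
      · intro i
        simp [θ, x, ← PowerSeries.coeff_zero_eq_constantCoeff_apply])
  have hψg' (s) : ψ (g s) = θ s := congr($hψg s)
  let fwd : HS φ →+* M := HS.lift φ ψ fun r n ↦ by
    rw [← hC, hψg']
    simp [θ]
  let bwd : M →+* HS φ :=
    MvPolynomial.eval₂Hom (HS.incl φ) fun p ↦ HS.D φ (p.2 + 1) (g (.X p.1))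
  have hbC (b : B) : bwd (.C b) = HS.D φ 0 b :=
    (MvPolynomial.eval₂Hom_C _ _ _).trans (HS.incl_apply _ _)
  have hbX (i : ι) (n : ℕ) : bwd (.X (i, n)) = HS.D φ (n + 1) (g (.X i)) :=
    MvPolynomial.eval₂Hom_X' _ _ _
  have h1 : (PowerSeries.map bwd).comp ψ = HS.univ φ := by
    refine arc_ext hg.formallyUnramified ?_ fun b ↦ ?_
    · rw [RingHom.comp_assoc, hψg]
      apply MvPolynomial.ringHom_ext
      · intro r
        ext n
        rcases n with _ | n
        · simp [θ, hbC, hC]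
        · simp [θ, hC, HS.D_const]
      · intro i
        ext n
        rcases n with _ | n
        · simp [θ, x, hbC]
        · simp [θ, x, hbX]
    · simp only [RingHom.comp_apply, ← PowerSeries.coeff_zero_eq_constantCoeff_apply,
        PowerSeries.coeff_map]
      rw [PowerSeries.coeff_zero_eq_constantCoeff_apply, hψ₀]
      simp [hbC]
  refine ⟨RingEquiv.ofRingHom fwd bwd ?_ ?_⟩
  · apply MvPolynomial.ringHom_ext
    · intro b
      simp [fwd, hbC, hψ₀]
    · rintro ⟨i, n⟩
      simp [fwd, hbX, hψg', θ, x]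
  · apply HS.hom_ext
    intro n b
    simpa [fwd] using congr(PowerSeries.coeff n ($h1 b))

end Etale

/-- On the arcs of a standard smooth algebra over a noetherian ring, a constructible set has
finitely many generic points. -/
theorem exists_finite_generic_HS {k B : Type u} [CommRing k] [IsNoetherianRing k] [CommRing B]
    {φ : k →+* B} (hφ : φ.IsStandardSmooth) {C : Set (PrimeSpectrum (HS φ))}
    (hC : IsConstructible C) :
    ∃ F : Set (PrimeSpectrum (HS φ)), F.Finite ∧ F ⊆ C ∧ ∀ q ∈ C, ∃ p ∈ F, p ⤳ q := by
  obtain ⟨n, g, hgφ, hg⟩ := hφ.exists_etale_mvPolynomial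
  have : IsNoetherianRing B := by
    let := g.toAlgebra
    have : Algebra.Etale (MvPolynomial (Fin n) k) B := hg
    exact Algebra.FiniteType.isNoetherianRing (MvPolynomial (Fin n) k) B
  obtain ⟨e⟩ := nonempty_ringEquiv_HS g hgφ hg
  obtain ⟨F, hF, hFC, hgen⟩ := exists_finite_generic_of_isConstructible
    finite_minimalPrimes_mvPolynomial (isConstructible_comap_preimage e.toRingHom hC)
  refine ⟨PrimeSpectrum.comap e.toRingHom '' F, hF.image _, Set.image_subset_iff.mpr hFC,
    fun q hq ↦ ?_⟩
  have hq' : PrimeSpectrum.comap e.toRingHom (PrimeSpectrum.comap e.symm.toRingHom q) = q := by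
    rw [← PrimeSpectrum.comap_comp_apply]
    simp
  obtain ⟨p, hpF, hp⟩ := hgen (PrimeSpectrum.comap e.symm.toRingHom q) (by
    rw [Set.mem_preimage, hq']
    exact hq)
  refine ⟨_, Set.mem_image_of_mem _ hpF, ?_⟩
  rw [← hq']
  exact hp.map (PrimeSpectrum.continuous_comap _)

/-! ### Lifting arcs along a map that becomes an isomorphism after localization -/

section Lifting

open PowerSeries

lemma X_mem_nonZeroDivisors {R : Type*} [CommRing R] : (X : R⟦X⟧) ∈ nonZeroDivisors R⟦X⟧ :=
  mem_nonZeroDivisors_iff_right.mpr fun x hx ↦ by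
    ext n
    simpa using congr(coeff (n + 1) $hx)

/-- The locally closed subscheme of `Spec H` on which the elements of `G` vanish and `d` does not is
affine and of finite presentation. -/
lemma exists_finitePresentation_locus {H : Type u} [CommRing H] (G : Finset H) (d : H) :
    ∃ (R : Type u) (_ : CommRing R) (ρ₀ : H →+* R), ρ₀.FinitePresentation ∧ (∀ x ∈ G, ρ₀ x = 0) ∧
      IsUnit (ρ₀ d) ∧ ∀ {K : Type u} [CommRing K] (q : H →+* K), (∀ x ∈ G, q x = 0) →
        IsUnit (q d) → ∃ ρ : R →+* K, ρ.comp ρ₀ = q := by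
  let J : Ideal H := Ideal.span G
  let R := Localization.Away (Ideal.Quotient.mk J d)
  let ρ₀ : H →+* R := (algebraMap (H ⧸ J) R).comp (Ideal.Quotient.mk J)
  refine ⟨R, inferInstance, ρ₀, ?_, fun x hx ↦ ?_,
    IsLocalization.Away.algebraMap_isUnit (S := R) (Ideal.Quotient.mk J d),
    fun {K} _ q hqG hqd ↦ ?_⟩
  · refine RingHom.FinitePresentation.comp ?_ (.of_surjective _ Ideal.Quotient.mk_surjective ?_)
    · exact RingHom.finitePresentation_algebraMap.mpr
        (IsLocalization.Away.finitePresentation (Ideal.Quotient.mk J d))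
    · rw [Ideal.mk_ker]
      exact ⟨G, rfl⟩
  · have : Ideal.Quotient.mk J x = 0 := Ideal.Quotient.eq_zero_iff_mem.mpr (Ideal.subset_span hx)
    simp [ρ₀, this]
  · have hJ : J ≤ RingHom.ker q := Ideal.span_le.mpr hqG
    let q' : H ⧸ J →+* K := Ideal.Quotient.lift J q hJ
    have hq' (x : H) : q' (Ideal.Quotient.mk J x) = q x := Ideal.Quotient.lift_mk J q hJ
    have hd : IsUnit (q' (Ideal.Quotient.mk J d)) := (hq' d).symm ▸ hqd
    refine ⟨IsLocalization.Away.lift (Ideal.Quotient.mk J d) hd, RingHom.ext fun x ↦ ?_⟩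
    exact (IsLocalization.Away.lift_eq _ hd _).trans (hq' x)

variable {k A B : Type u} [CommRing k] [CommRing A] [CommRing B]

/-- Let `φ : A → B` become an isomorphism after inverting `g`, and let `β` be an arc of `A` along
which `g` has order exactly `e`. Then `β` extends to `B` as soon as, for generators
`b = a / g ^ n` of `B`, the order of `a` along `β` is at least `n * e`. The hypothesis `hs` says
that `s` generates `B` as a `k`-algebra. -/
lemma exists_arc_extension {R C : Type*} [CommRing R] [CommRing C] {φ : A →+* B} {φk : k →+* A}
    {g : A} [Algebra A C] [IsLocalization.Away g C] {j : B →+* C} (hj : j.comp φ = algebraMap A C)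
    {β : A →+* R⟦X⟧} {e : ℕ} {v : R⟦X⟧} (hv : IsUnit v) (hβ : β g = X ^ e * v)
    {s : Set B} (hs : ∀ S : Subring B, (∀ r, φ (φk r) ∈ S) → s ⊆ S → S = ⊤)
    {n : B → ℕ} {a : B → A} (ha : ∀ b, φ (a b) = φ g ^ n b * b)
    (hdvd : ∀ b ∈ s, X ^ (e * n b) ∣ β (a b)) :
    ∃ ψ : B →+* R⟦X⟧, ψ.comp φ = β := by
  let L := Localization.Away (X : R⟦X⟧)
  let ℓ : R⟦X⟧ →+* L := algebraMap _ _
  have hℓ : Function.Injective ℓ := IsLocalization.injective L (M := Submonoid.powers X)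
    (Submonoid.powers_le.mpr X_mem_nonZeroDivisors)
  have hX : IsUnit (ℓ X) := IsLocalization.Away.algebraMap_isUnit _
  have hg : IsUnit (ℓ.comp β g) := by
    rw [RingHom.comp_apply, hβ, map_mul, map_pow]
    exact (hX.pow e).mul (hv.map ℓ)
  let γ : B →+* L := (IsLocalization.Away.lift g hg).comp j
  have hγ (x : A) : γ (φ x) = ℓ (β x) := by
    have : j (φ x) = algebraMap A C x := congr($hj x)
    simp [γ, this]
  have hrange : ℓ.range.comap γ = ⊤ := by
    refine hs _ (fun r ↦ ⟨β (φk r), (hγ _).symm⟩) fun b hb ↦ ?_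
    obtain ⟨c, hc⟩ := hdvd b hb
    obtain ⟨w, rfl⟩ := hv
    refine ⟨c * ((w⁻¹ ^ n b : R⟦X⟧ˣ) : R⟦X⟧), (hg.pow (n b)).mul_left_cancel ?_⟩
    have h1 : γ (φ (a b)) = (ℓ.comp β g) ^ n b * γ b := by
      rw [ha, map_mul, map_pow, hγ]
      rfl
    rw [← h1, hγ, hc, RingHom.comp_apply, hβ, ← map_pow, ← map_mul]
    congr 1
    have hw : (w : R⟦X⟧) ^ n b * ((w⁻¹ ^ n b : R⟦X⟧ˣ) : R⟦X⟧) = 1 := by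
      rw [← Units.val_pow_eq_pow_val, ← Units.val_mul]
      simp
    calc _ = X ^ (e * n b) * c * ((w : R⟦X⟧) ^ n b * ((w⁻¹ ^ n b : R⟦X⟧ˣ) : R⟦X⟧)) := by ring
      _ = _ := by rw [hw, mul_one]
  have hmem (b : B) : γ b ∈ ℓ.range := by
    have : b ∈ ℓ.range.comap γ := hrange ▸ Subring.mem_top b
    exact this
  let ε : R⟦X⟧ ≃+* ℓ.range := RingEquiv.ofBijective ℓ.rangeRestrict
    ⟨fun x y h ↦ hℓ congr(Subtype.val $h), ℓ.rangeRestrict_surjective⟩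
  refine ⟨ε.symm.toRingHom.comp (γ.codRestrict _ hmem), RingHom.ext fun x ↦ ?_⟩
  refine ε.injective ?_
  apply Subtype.ext
  simp only [RingHom.comp_apply, RingEquiv.toRingHom_eq_coe, RingHom.coe_coe,
    RingEquiv.apply_symm_apply]
  exact hγ x

/-- The arcs of `B` along which `g` has order `e` form a scheme which is of finite presentation over
the arcs of `A`, if `φ : A → B` becomes an isomorphism after inverting `g`. By Chevalley's theorem,
the image of a constructible set `E` contains a constructible set which contains the image of a
given arc `P ∈ E` along which `g` is not identically zero. -/
theorem exists_isConstructible_HS {C : Type*} [CommRing C] {φ : A →+* B} {φk : k →+* A}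
    {φB : k →+* B} (hφ : φ.comp φk = φB) (hfin : φB.FiniteType)
    {g : A} [Algebra A C] [IsLocalization.Away g C] {j : B →+* C} (hj : j.comp φ = algebraMap A C)
    (hB : ∀ b, ∃ n a, φ a = φ g ^ n * b)
    {E : Set (PrimeSpectrum (HS φB))} (hE : IsConstructible E) {P : PrimeSpectrum (HS φB)}
    (hP : P ∈ E) {m : ℕ} (hm : HS.D φB m (φ g) ∉ P.asIdeal) :
    ∃ D : Set (PrimeSpectrum (HS φk)), IsConstructible D ∧
      PrimeSpectrum.comap (HS.map φ hφ) P ∈ D ∧ D ⊆ PrimeSpectrum.comap (HS.map φ hφ) '' E := by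
  classical
  have hex : ∃ m, HS.D φB m (φ g) ∉ P.asIdeal := ⟨m, hm⟩
  let e := Nat.find hex
  have he : HS.D φB e (φ g) ∉ P.asIdeal := Nat.find_spec hex
  have he' : ∀ i < e, HS.D φB i (φ g) ∈ P.asIdeal := fun i hi ↦ not_not.mp (Nat.find_min hex hi)
  choose n a ha using hB
  obtain ⟨s, hs⟩ : ∃ s : Finset B, ∀ S : Subring B,
      (∀ r, φ (φk r) ∈ S) → (s : Set B) ⊆ S → S = ⊤ := by
    let := φB.toAlgebra
    obtain ⟨s, hs⟩ := Algebra.FiniteType.out (R := k) (A := B) (self := hfin)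
    refine ⟨s, fun S hS hsS ↦ ?_⟩
    let S' : Subalgebra k B :=
      { S with algebraMap_mem' := fun r ↦ by
                change φB r ∈ S
                rw [← hφ]; exact hS r }
    have : S' = ⊤ := top_le_iff.mp (hs ▸ Algebra.adjoin_le hsS)
    ext b
    have hb : b ∈ S' := this ▸ Algebra.mem_top
    exact ⟨fun _ ↦ trivial, fun _ ↦ hb⟩
  -- the ring `R` of functions on the locus in `Spec (HS φk)` where `g` has order exactly `e`, and
  -- `a b` has order at least `e * n b` for each of the generators `b`
  let G : Finset (HS φk) := (Finset.range e).image (fun i ↦ HS.D φk i g) ∪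
    s.biUnion fun b ↦ (Finset.range (e * n b)).image fun i ↦ HS.D φk i (a b)
  obtain ⟨R, _, ρ₀, hρ₀, hρ₀G, hρ₀g, hR⟩ := exists_finitePresentation_locus G (HS.D φk e g)
  let β : A →+* R⟦X⟧ := (PowerSeries.map ρ₀).comp (HS.univ φk)
  have hβ (i x) : coeff i (β x) = ρ₀ (HS.D φk i x) := by simp [β]
  obtain ⟨v, hβv⟩ : X ^ e ∣ β g := by
    rw [X_pow_dvd_iff]
    intro i hi
    rw [hβ]
    exact hρ₀G _ (Finset.mem_union_left _ (Finset.mem_image_of_mem _ (Finset.mem_range.mpr hi)))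
  have hv : IsUnit v := by
    rw [PowerSeries.isUnit_iff_constantCoeff]
    have h1 := hβ e g
    have h2 := coeff_X_pow_mul v e 0
    rw [zero_add] at h2
    rw [hβv, h2, coeff_zero_eq_constantCoeff_apply] at h1
    rw [h1]
    exact hρ₀g
  obtain ⟨ψ, hψ⟩ := exists_arc_extension hj hv hβv hs ha (fun b hb ↦ by
    rw [X_pow_dvd_iff]
    intro i hi
    rw [hβ]
    exact hρ₀G _ (Finset.mem_union_right _ (Finset.mem_biUnion.mpr
      ⟨b, hb, Finset.mem_image_of_mem _ (Finset.mem_range.mpr hi)⟩)))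
  have hψ' (x : A) : ψ (φ x) = β x := congr($hψ x)
  let σ : HS φB →+* R := HS.lift φB ψ fun r i ↦ by
    subst hφ
    rw [RingHom.comp_apply, hψ', hβ, HS.D_const, map_zero]
  have hσ : σ.comp (HS.map φ hφ) = ρ₀ := by
    apply HS.hom_ext
    intro i x
    simp [σ, hψ', hβ]
  refine ⟨PrimeSpectrum.comap ρ₀ '' (PrimeSpectrum.comap σ ⁻¹' E),
    PrimeSpectrum.isConstructible_comap_image hρ₀ (isConstructible_comap_preimage σ hE), ?_, ?_⟩
  · -- the arc `q` corresponding to `P` factors through `σ`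
    let κ := P.asIdeal.ResidueField
    let q : HS φB →+* κ := algebraMap _ _
    have hq (x) : q x = 0 ↔ x ∈ P.asIdeal := Ideal.algebraMap_residueField_eq_zero
    let α : B →+* κ⟦X⟧ := (PowerSeries.map q).comp (HS.univ φB)
    have hα (i b) : coeff i (α b) = q (HS.D φB i b) := by simp [α]
    have hαg : X ^ e ∣ α (φ g) := by
      rw [X_pow_dvd_iff]
      intro i hi
      rw [hα, hq]
      exact he' i hi
    have hαg0 : α (φ g) ≠ 0 := fun h ↦ he <| by
      rw [← hq, ← hα, h, map_zero]
    obtain ⟨ρ, hρ⟩ := hR (q.comp (HS.map φ hφ)) (fun x hx ↦ by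
      rw [RingHom.comp_apply]
      rcases Finset.mem_union.mp hx with hx | hx
      · obtain ⟨i, hi, rfl⟩ := Finset.mem_image.mp hx
        rw [HS.map_D, hq]
        exact he' i (Finset.mem_range.mp hi)
      · obtain ⟨b, hb, hx⟩ := Finset.mem_biUnion.mp hx
        obtain ⟨i, hi, rfl⟩ := Finset.mem_image.mp hx
        rw [HS.map_D, ← hα, ha, map_mul, map_pow]
        refine X_pow_dvd_iff.mp (Dvd.dvd.mul_right ?_ _) i (Finset.mem_range.mp hi)
        rw [pow_mul]
        exact pow_dvd_pow_of_dvd hαg _) (by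
      rw [RingHom.comp_apply, HS.map_D, isUnit_iff_ne_zero, ne_eq, hq]
      exact he)
    have hρσ : ρ.comp σ = q := by
      apply HS.hom_ext
      intro i b
      suffices h : (PowerSeries.map ρ) (ψ b) = α b by
        simpa [σ, hα] using congr(coeff i $h)
      have hA (x : A) : PowerSeries.map ρ (ψ (φ x)) = α (φ x) := by
        ext i
        rw [hψ', coeff_map, hβ, hα, ← HS.map_D φ hφ]
        exact congr($hρ _)
      have h := hA (a b)
      rw [ha, map_mul, map_mul, map_mul, map_pow, map_pow, map_pow, hA] at h
      exact mul_left_cancel₀ (pow_ne_zero _ hαg0) h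
    have hqP : PrimeSpectrum.comap q ⊥ = P := by
      ext x
      exact hq x
    refine ⟨PrimeSpectrum.comap ρ ⊥, ?_, ?_⟩
    · rw [Set.mem_preimage, ← PrimeSpectrum.comap_comp_apply, hρσ, hqP]
      exact hP
    · rw [← PrimeSpectrum.comap_comp_apply, hρ, PrimeSpectrum.comap_comp_apply, hqP]
  · rintro _ ⟨Q, hQ, rfl⟩
    exact ⟨_, hQ, by rw [← PrimeSpectrum.comap_comp_apply, hσ]⟩

end Lifting

/-! ### Charts of arc spaces -/

section Charts

variable {k : Type u} [CommRing k]

instance isAffineHom_arcsProj (X : Over (Spec (CommRingCat.of k))) : IsAffineHom (arcsProj X) := by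
  refine isAffineHom_of_forall_exists_isAffineOpen _ fun x ↦ ?_
  obtain ⟨_, ⟨U, hU, rfl⟩, hxU, -⟩ := X.left.isBasis_affineOpens.exists_subset_of_mem_open
    (Set.mem_univ x) isOpen_univ
  let U' : X.left.AffineZariskiSite := ⟨U, hU⟩
  refine ⟨U, hxU, hU, ?_⟩
  have h : (arcsChart X U').opensRange = arcsProj X ⁻¹ᵁ U := opensRange_arcsChart X U'
  rw [← h]
  exact isAffineOpen_opensRange (arcsChart X U')

lemma isConstructible_image_arcsChart (X : Over (Spec (CommRingCat.of k)))
    [QuasiSeparatedSpace X.left] (U : X.left.AffineZariskiSite)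
    {D : Set (PrimeSpectrum (HS (baseHom X U.1)))} (hD : IsConstructible D) :
    IsConstructible (arcsChart X U '' D) := by
  have : QuasiSeparatedSpace (arcs X) := quasiSeparatedSpace_of_quasiSeparated (arcsProj X)
  refine hD.image_of_isOpenEmbedding (arcsChart X U).isOpenEmbedding ?_
  exact IsCompact.isRetrocompact (isAffineOpen_opensRange (arcsChart X U)).isCompact
    (arcsChart X U).opensRange.2

lemma arcsMap_arcsChart_apply {X Y : Over (Spec (CommRingCat.of k))} (f : Y ⟶ X)
    (U : X.left.AffineZariskiSite) (V : Y.left.AffineZariskiSite) (h : V.1 ≤ f.left ⁻¹ᵁ U.1)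
    (P : PrimeSpectrum (HS (baseHom Y V.1))) :
    arcsMap f (arcsChart Y V P) = arcsChart X U (PrimeSpectrum.comap
      (HS.map (f.left.appLE U.1 V.1 h).hom (appLE_comp_baseHom f h)) P) := by
  exact congr($(arcsChart_arcsMap f U V h) P)

end Charts

/-! ### Arcs of a smooth scheme -/

/-- A smooth scheme over a field is covered by affine open subsets with étale coordinates. -/
lemma exists_isStandardSmooth_baseHom {k : Type u} [Field k] (Y : Over (Spec (CommRingCat.of k)))
    [Smooth Y.hom] (y : Y.left) :
    ∃ V : Y.left.AffineZariskiSite, y ∈ V.1 ∧ (baseHom Y V.1).IsStandardSmooth := by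
  obtain ⟨U, hU, V, hV, hyV, e, h⟩ := Smooth.exists_isStandardSmooth Y.hom y
  have hUtop : U = ⊤ := by
    ext x
    have : x = Y.hom y := Subsingleton.elim (α := PrimeSpectrum k) _ _
    simpa [this] using e hyV
  subst hUtop
  exact ⟨⟨V, hV⟩, hyV, RingHom.isStandardSmooth_respectsIso.2 _
    (Scheme.ΓSpecIso (CommRingCat.of k)).symm.commRingCatIsoToRingEquiv h⟩

/-- A constructible set of arcs of a smooth scheme has finitely many generic points. -/
theorem exists_finite_generic_arcs {k : Type u} [Field k] (Y : Over (Spec (CommRingCat.of k)))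
    [Smooth Y.hom] [CompactSpace Y.left] {C : Set (arcs Y)} (hC : IsConstructible C) :
    ∃ F : Set (arcs Y), F.Finite ∧ F ⊆ C ∧ ∀ y ∈ C, ∃ η ∈ F, η ⤳ y := by
  choose V hyV hV using exists_isStandardSmooth_baseHom Y
  obtain ⟨t, ht⟩ := isCompact_univ.elim_finite_subcover (fun y ↦ ((V y).1 : Set Y.left))
    (fun y ↦ (V y).1.2) fun y _ ↦ Set.mem_iUnion.mpr ⟨y, hyV y⟩
  choose F hF hFC hgen using fun y ↦ exists_finite_generic_HS (hV y)
    (hC.preimage_of_isOpenEmbedding (arcsChart Y (V y)).isOpenEmbedding)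
  refine ⟨⋃ y ∈ t, arcsChart Y (V y) '' F y, t.finite_toSet.biUnion fun y _ ↦ (hF y).image _,
    Set.iUnion₂_subset fun y _ ↦ Set.image_subset_iff.mpr (hFC y), fun z hz ↦ ?_⟩
  obtain ⟨y, hyt, hy⟩ := Set.mem_iUnion₂.mp (ht (Set.mem_univ (arcsProj Y z)))
  obtain ⟨q, rfl⟩ := (mem_arcsChart_iff Y (V y) z).mpr hy
  obtain ⟨p, hpF, hp⟩ := hgen y q hz
  exact ⟨_, Set.mem_biUnion hyt (Set.mem_image_of_mem _ hpF),
    hp.map (arcsChart Y (V y)).continuous⟩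

/-! ### Arcs in the exceptional locus -/

section Exceptional

open PowerSeries

variable {k : Type u} [CommRing k]

/-- An arc along which the equations of the exceptional locus vanish lies in its arc space. -/
lemma arcsChart_mem_exceptionalArcs {X Y : Over (Spec (CommRingCat.of k))} (f : Y ⟶ X)
    (V : Y.left.AffineZariskiSite) (P : PrimeSpectrum (HS (baseHom Y V.1)))
    (hP : ∀ a ∈ (Scheme.IdealSheafData.vanishingIdeal (exceptionalLocus f.left)).ideal ⟨V.1, V.2⟩,
      ∀ n, HS.D (baseHom Y V.1) n a ∈ P.asIdeal) :
    arcsChart Y V P ∈ exceptionalArcs f := by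
  let 𝓘 := Scheme.IdealSheafData.vanishingIdeal (exceptionalLocus f.left)
  let W : (exceptionalScheme f).left.AffineZariskiSite :=
    ⟨(exceptionalι f).left ⁻¹ᵁ V.1, V.2.preimage 𝓘.subschemeι⟩
  let s := ((exceptionalι f).left.appLE V.1 W.1 le_rfl).hom
  have hs : s = (𝓘.subschemeι.app V.1).hom := by
    exact congr(($(Scheme.Hom.appLE_eq_app (f := 𝓘.subschemeι) (U := V.1))).hom)
  have hsurj : Function.Surjective s := hs ▸ 𝓘.subschemeι_app_surjective ⟨V.1, V.2⟩
  have hker : RingHom.ker s = 𝓘.ideal ⟨V.1, V.2⟩ := hs ▸ 𝓘.ker_subschemeι_app ⟨V.1, V.2⟩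
  let κ := P.asIdeal.ResidueField
  let q : HS (baseHom Y V.1) →+* κ := algebraMap _ _
  have hq (x) : q x = 0 ↔ x ∈ P.asIdeal := Ideal.algebraMap_residueField_eq_zero
  let α : Γ(Y.left, V.1) →+* κ⟦X⟧ := (PowerSeries.map q).comp (HS.univ _)
  have hα : RingHom.ker s ≤ RingHom.ker α := fun a ha ↦ by
    rw [hker] at ha
    ext n
    simpa [α, hq] using hP a ha n
  let α' : Γ((exceptionalScheme f).left, W.1) →+* κ⟦X⟧ := s.liftOfSurjective hsurj ⟨α, hα⟩
  have hα' (a) : α' (s a) = α a := RingHom.liftOfRightInverse_comp_apply ..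
  have hbase : s.comp (baseHom Y V.1) = baseHom (exceptionalScheme f) W.1 :=
    appLE_comp_baseHom (exceptionalι f) le_rfl
  let q' : HS (baseHom (exceptionalScheme f) W.1) →+* κ := HS.lift _ α' fun r n ↦ by
    rw [← hbase, RingHom.comp_apply, hα']
    simp [α, HS.D_const]
  have hq' : q'.comp (HS.map s hbase) = q := by
    apply HS.hom_ext
    intro n a
    simp [q', hα', α]
  refine ⟨arcsChart (exceptionalScheme f) W (PrimeSpectrum.comap q' ⊥), ?_⟩
  rw [arcsMap_arcsChart_apply (exceptionalι f) V W le_rfl, ← PrimeSpectrum.comap_comp_apply]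
  refine congr(arcsChart Y V $(PrimeSpectrum.ext (Ideal.ext fun x ↦ ?_)))
  exact (congr($hq' x = 0).to_iff).trans (hq x)

end Exceptional

/-! ### Localizing at a function on the target -/

/-- If `f` is an isomorphism over a neighbourhood of `f y`, then over a basic open neighbourhood
`D(g)` of `f y` it is an isomorphism with source contained in a given affine neighbourhood of
`y`. -/
lemma exists_basicOpen_isIso {X Y : Scheme.{u}} (f : Y ⟶ X) {U : X.Opens} {V : Y.Opens}
    (hU : IsAffineOpen U) (h : V ≤ f ⁻¹ᵁ U) {y : Y} (hyV : y ∈ V) (hy : f y ∈ isoLocus f) :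
    ∃ g : Γ(X, U), f y ∈ X.basicOpen g ∧ f ⁻¹ᵁ X.basicOpen g ≤ V ∧
      IsIso (f.app (X.basicOpen g)) := by
  obtain ⟨W, hW, hyW⟩ := TopologicalSpace.Opens.mem_sSup.mp hy
  replace hW : IsIso (f ∣_ W) := hW
  let W : X.Opens := W
  have hinv (z : Y) (hz : f z ∈ W) : inv (f ∣_ W) ⟨f z, hz⟩ = ⟨z, hz⟩ := by
    have : (f ∣_ W) ⟨z, hz⟩ = ⟨f z, hz⟩ := Subtype.ext (morphismRestrict_base_coe f W ⟨z, hz⟩)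
    rw [← this]
    exact congr($(IsIso.hom_inv_id (f ∣_ W)) ⟨z, hz⟩)
  let O : X.Opens := W.ι ''ᵁ (inv (f ∣_ W) ⁻¹ᵁ ((f ⁻¹ᵁ W).ι ⁻¹ᵁ V))
  have hO (z : Y) (hz : f z ∈ W) : f z ∈ O ↔ z ∈ V := by
    constructor
    · rintro ⟨w, hw, hwz⟩
      obtain rfl : w = ⟨f z, hz⟩ := Subtype.ext hwz
      have : (f ⁻¹ᵁ W).ι (inv (f ∣_ W) ⟨f z, hz⟩) ∈ V := hw
      rwa [hinv] at this
    · intro hzV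
      refine ⟨⟨f z, hz⟩, ?_, rfl⟩
      change (f ⁻¹ᵁ W).ι (inv (f ∣_ W) ⟨f z, hz⟩) ∈ V
      rwa [hinv]
  have hOW : O ≤ W := by
    rintro _ ⟨w, _, rfl⟩
    exact w.2
  obtain ⟨g, hg, hyg⟩ := hU.exists_basicOpen_le (V := O) ⟨f y, (hO y hyW).mpr hyV⟩ (h hyV)
  refine ⟨g, hyg, fun z hz ↦ (hO z (hOW (hg hz))).mp (hg hz), ?_⟩
  have key : IsIso (f.app (W.ι ''ᵁ (W.ι ⁻¹ᵁ X.basicOpen g))) := by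
    have h1 := morphismRestrict_app f W (W.ι ⁻¹ᵁ X.basicOpen g)
    have h2 : IsIso ((f ∣_ W).app (W.ι ⁻¹ᵁ X.basicOpen g)) := inferInstance
    have h3 : IsIso (Y.presheaf.map
        (eqToHom (image_morphismRestrict_preimage f W (W.ι ⁻¹ᵁ X.basicOpen g))).op) :=
      inferInstance
    rw [h1] at h2
    exact @IsIso.of_isIso_comp_right _ _ _ _ _ _ _ h3 h2
  rwa [Scheme.Hom.image_preimage_eq_opensRange_inf, Scheme.Opens.opensRange_ι,
    inf_eq_right.mpr (hg.trans hOW)] at key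

/-- In the situation of `exists_basicOpen_isIso`, the ring map `Γ(X, U) → Γ(Y, V)` becomes an
isomorphism after inverting `g`. -/
lemma exists_appLE_localization {X Y : Scheme.{u}} (f : Y ⟶ X) {U : X.Opens} {V : Y.Opens}
    (hU : IsAffineOpen U) (hV : IsAffineOpen V) (h : V ≤ f ⁻¹ᵁ U) (g : Γ(X, U))
    (hgV : f ⁻¹ᵁ X.basicOpen g ≤ V) [IsIso (f.app (X.basicOpen g))] :
    (∃ j : Γ(Y, V) →+* Γ(X, X.basicOpen g), j.comp (f.appLE U V h).hom =
      (X.presheaf.map (homOfLE (X.basicOpen_le g)).op).hom) ∧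
    ∀ b : Γ(Y, V), ∃ (n : ℕ) (a : Γ(X, U)),
      f.appLE U V h a = f.appLE U V h g ^ n * b := by
  let D := X.basicOpen g
  let φ := (f.appLE U V h).hom
  let rX := (X.presheaf.map (homOfLE (X.basicOpen_le g)).op).hom
  let rY := (Y.presheaf.map (homOfLE hgV).op).hom
  let i := (f.app D).hom
  let i' := (inv (f.app D)).hom
  have hi (x) : i' (i x) = x := congr($(IsIso.hom_inv_id (f.app D)) x)
  have hi' (x) : i (i' x) = x := congr($(IsIso.inv_hom_id (f.app D)) x)
  have hcomm (a) : rY (φ a) = i (rX a) := by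
    have : f.appLE U V h ≫ Y.presheaf.map (homOfLE hgV).op =
        X.presheaf.map (homOfLE (X.basicOpen_le g)).op ≫ f.app D := by
      rw [Scheme.Hom.appLE_map, ← Scheme.Hom.appLE_eq_app, Scheme.Hom.map_appLE]
    exact congr($this a)
  have hD : f ⁻¹ᵁ D = Y.basicOpen (φ g) := by
    have : Y.basicOpen (φ g) = V ⊓ f ⁻¹ᵁ D := by
      simp [φ, D, Scheme.Hom.appLE, Scheme.preimage_basicOpen]
    rw [this, inf_eq_right.mpr hgV]
  let := rX.toAlgebra
  let := rY.toAlgebra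
  have : IsLocalization.Away g Γ(X, D) := hU.isLocalization_basicOpen g
  have : IsLocalization.Away (φ g) Γ(Y, f ⁻¹ᵁ D) :=
    hV.isLocalization_of_eq_basicOpen (φ g) (homOfLE hgV) hD
  refine ⟨⟨i'.comp rY, RingHom.ext fun a ↦ ?_⟩, fun b ↦ ?_⟩
  · exact (congr(i' $(hcomm a))).trans (hi _)
  · obtain ⟨n, a, ha⟩ := IsLocalization.Away.surj g (i' (rY b))
    have h1 : rY (φ g ^ n * b) = rY (φ a) := by
      have := congr(i $ha)
      rw [map_mul, hi', map_pow] at this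
      rw [map_mul, map_pow, hcomm, hcomm, mul_comm]
      exact this
    obtain ⟨⟨_, m, rfl⟩, hm⟩ :=
      IsLocalization.exists_of_eq (M := Submonoid.powers (φ g)) (S := Γ(Y, f ⁻¹ᵁ D)) h1
    refine ⟨m + n, g ^ m * a, ?_⟩
    change φ _ = φ g ^ _ * b
    rw [map_mul, map_pow, ← hm, pow_add, mul_assoc]

/-! ### Images of constructible sets of arcs -/

open PowerSeries in
/-- The generic point of an arc `η` not contained in `Ex(f)` lies in the open set where `f` is an
isomorphism, so the lifting of arcs applies to a function `g` which does not vanish there. The arc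
`η` is known to be outside `Ex(f)_∞` because it has a specialization `y` outside. -/
theorem exists_isConstructible_subset_image {k : Type u} [Field k]
    {X Y : Over (Spec (CommRingCat.of k))} [QuasiSeparatedSpace X.left]
    [LocallyOfFiniteType Y.hom] (f : Y ⟶ X) {C : Set (arcs Y)} (hC : IsConstructible C)
    {η y : arcs Y} (hη : η ∈ C) (hηy : η ⤳ y) (hy : y ∉ exceptionalArcs f) :
    ∃ D : Set (arcs X), IsConstructible D ∧ arcsMap f η ∈ D ∧ D ⊆ arcsMap f '' C := by
  obtain ⟨_, ⟨U, hU, rfl⟩, hyU, -⟩ := X.left.isBasis_affineOpens.exists_subset_of_mem_open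
    (Set.mem_univ (f.left (arcsProj Y y))) isOpen_univ
  obtain ⟨_, ⟨V, hV, rfl⟩, hyV, hVU⟩ := Y.left.isBasis_affineOpens.exists_subset_of_mem_open
    (show arcsProj Y y ∈ f.left ⁻¹ᵁ U from hyU) (f.left ⁻¹ᵁ U).2
  let U' : X.left.AffineZariskiSite := ⟨U, hU⟩
  let V' : Y.left.AffineZariskiSite := ⟨V, hV⟩
  have h : V ≤ f.left ⁻¹ᵁ U := hVU
  obtain ⟨Q, rfl⟩ := (mem_arcsChart_iff Y V' y).mpr hyV
  obtain ⟨P, rfl⟩ := hηy.mem_open (arcsChart Y V').isOpenEmbedding.isOpen_range ⟨Q, rfl⟩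
  have hPQ : PrimeSpectrum.asIdeal P ≤ PrimeSpectrum.asIdeal Q :=
    (PrimeSpectrum.le_iff_specializes _ _).mpr
      ((arcsChart Y V').isOpenEmbedding.isInducing.specializes_iff.mp hηy)
  -- the equations of `Ex(f)` that vanish along the arc `P` vanish along its specialization `Q`
  obtain ⟨a, ha, n, hn⟩ : ∃ a ∈ (Scheme.IdealSheafData.vanishingIdeal
      (exceptionalLocus f.left)).ideal ⟨V, hV⟩, ∃ n,
      HS.D (baseHom Y V) n a ∉ PrimeSpectrum.asIdeal P := by
    by_contra! hcon
    exact hy (arcsChart_mem_exceptionalArcs f V' Q fun a ha n ↦ hPQ (hcon a ha n))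
  have : (PrimeSpectrum.asIdeal P).IsPrime := PrimeSpectrum.isPrime P
  let q : HS (baseHom Y V) →+* (PrimeSpectrum.asIdeal P).ResidueField := algebraMap _ _
  have hq (x) : q x = 0 ↔ x ∈ PrimeSpectrum.asIdeal P := Ideal.algebraMap_residueField_eq_zero
  let α := (PowerSeries.map q).comp (HS.univ (baseHom Y V))
  have hα (i b) : coeff i (α b) = q (HS.D (baseHom Y V) i b) := by simp [α]
  -- the generic point `p` of the arc `P`
  let p : PrimeSpectrum Γ(Y.left, V) := PrimeSpectrum.comap α ⊥
  have hp (b) : b ∈ p.asIdeal ↔ α b = 0 := Iff.rfl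
  have hap : a ∉ p.asIdeal := fun h0 ↦ hn <| by
    rw [← hq, ← hα, (hp a).mp h0, map_zero]
  have hpE : f.left (hV.fromSpec p) ∈ isoLocus f.left := by
    by_contra hcon
    rw [Scheme.IdealSheafData.vanishingIdeal_ideal] at ha
    exact hap ((PrimeSpectrum.mem_vanishingIdeal _ _).mp ha p hcon)
  have hpV : hV.fromSpec p ∈ V := by
    have : hV.fromSpec p ∈ Set.range hV.fromSpec := ⟨p, rfl⟩
    rwa [hV.range_fromSpec] at this
  obtain ⟨g, hpg, hgV, hiso⟩ := exists_basicOpen_isIso f.left hU h hpV hpE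
  obtain ⟨⟨j, hj⟩, hB⟩ := exists_appLE_localization f.left hU hV h g hgV
  obtain ⟨m, hm⟩ : ∃ m, HS.D (baseHom Y V) m (f.left.appLE U V h g) ∉
      PrimeSpectrum.asIdeal P := by
    by_contra! hcon
    have hgp : f.left.appLE U V h g ∈ p.asIdeal := (hp _).mpr <| by
      ext i
      rw [hα, map_zero, hq]
      exact hcon i
    have hmem : hV.fromSpec p ∈ Y.left.basicOpen (f.left.appLE U V h g) := by
      have : Y.left.basicOpen (f.left.appLE U V h g) = V ⊓ f.left ⁻¹ᵁ X.left.basicOpen g := by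
        simp [Scheme.Hom.appLE, Scheme.preimage_basicOpen]
      rw [this]
      exact ⟨hpV, hpg⟩
    have : p ∈ PrimeSpectrum.basicOpen (f.left.appLE U V h g) := by
      rw [← hV.fromSpec_preimage_basicOpen]
      exact hmem
    exact this hgp
  let := (X.left.presheaf.map (homOfLE (X.left.basicOpen_le g)).op).hom.toAlgebra
  have : IsLocalization.Away g Γ(X.left, X.left.basicOpen g) := hU.isLocalization_basicOpen g
  have hfin : (baseHom Y V).FiniteType := by
    refine RingHom.finiteType_respectsIso.2 _
      (Scheme.ΓSpecIso (CommRingCat.of k)).symm.commRingCatIsoToRingEquiv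
      (LocallyOfFiniteType.finiteType_appLE Y.hom (isAffineOpen_top _) hV le_top)
  obtain ⟨D, hD, hPD, hDC⟩ := exists_isConstructible_HS (appLE_comp_baseHom f h) hfin hj hB
    (hC.preimage_of_isOpenEmbedding (arcsChart Y V').isOpenEmbedding) (P := P) hη hm
  refine ⟨arcsChart X U' '' D, isConstructible_image_arcsChart X U' hD, ?_, ?_⟩
  · exact ⟨_, hPD, (arcsMap_arcsChart_apply f U' V' h P).symm⟩
  · rintro _ ⟨x, hx, rfl⟩
    obtain ⟨z, hz, rfl⟩ := hDC hx
    exact ⟨_, hz, arcsMap_arcsChart_apply f U' V' h z⟩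

end ArcSpace

theorem mainTheorem4 {k : Type u} [Field k] [IsAlgClosed k] [CharZero k]
    (X Y : Over (Spec (CommRingCat.of k))) (hX : ArcSpace.IsVariety X)
    (f : Y ⟶ X) (hf : ArcSpace.IsResolution f)
    (C : Set (ArcSpace.arcs Y)) (hC : IsConstructible C)
    (hCE : ∀ T ∈ irreducibleComponents (closure C),
      ¬ (Subtype.val '' T ⊆ ArcSpace.exceptionalArcs f)) :
    ∃ D : Set (ArcSpace.arcs X), IsConstructible D ∧
      D ⊆ ArcSpace.arcsMap f '' C ∧ ArcSpace.arcsMap f '' C ⊆ closure D := by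
  have := hX.isSeparated
  have := hf.smooth
  have := hf.isVariety.quasiCompact
  have := hf.isVariety.locallyOfFiniteType
  have : QuasiSeparatedSpace X.left := quasiSeparatedSpace_of_quasiSeparated X.hom
  have : CompactSpace Y.left := (quasiCompact_iff_compactSpace Y.hom).mp inferInstance
  obtain ⟨F, hF, hFC, hgen⟩ := ArcSpace.exists_finite_generic_arcs Y hC
  let F' := {η ∈ F | ∃ y, η ⤳ y ∧ y ∉ ArcSpace.exceptionalArcs f}
  have hF' : F'.Finite := hF.subset fun _ h ↦ h.1
  have hclosure : closure C ⊆ ⋃ η ∈ F, closure {η} :=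
    closure_minimal (fun y hy ↦ by
      obtain ⟨η, hη, hηy⟩ := hgen y hy
      exact Set.mem_biUnion hη hηy.mem_closure) (hF.isClosed_biUnion fun _ _ ↦ isClosed_closure)
  -- every component of the closure is contained in the closure of one of the generic points
  have hdense (y) (hy : y ∈ C) : ∃ η ∈ F', η ⤳ y := by
    let y' : closure C := ⟨y, subset_closure hy⟩
    let T := irreducibleComponent y'
    have hT : IsIrreducible (Subtype.val '' T) :=
      isIrreducible_irreducibleComponent.image _ continuous_subtype_val.continuousOn
    classical
    obtain ⟨_, hz, hTz⟩ := isIrreducible_iff_sUnion_isClosed.mp hT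
      (hF.toFinset.image fun η ↦ closure {η}) (by simp +contextual) (by
        rintro _ ⟨z, -, rfl⟩
        simpa using hclosure z.2)
    obtain ⟨η, hη, rfl⟩ := Finset.mem_image.mp hz
    obtain ⟨z, hzT, hzE⟩ :=
      Set.not_subset.mp (hCE T (irreducibleComponent_mem_irreducibleComponents y'))
    refine ⟨η, ⟨hF.mem_toFinset.mp hη, z, ?_, hzE⟩, ?_⟩
    · exact specializes_iff_mem_closure.mpr (hTz hzT)
    · exact specializes_iff_mem_closure.mpr (hTz ⟨y', mem_irreducibleComponent, rfl⟩)
  choose! D hD hηD hDC using fun η (hη : η ∈ F') ↦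
    have ⟨y, hηy, hy⟩ := hη.2
    ArcSpace.exists_isConstructible_subset_image f hC (hFC hη.1) hηy hy
  refine ⟨⋃ η ∈ F', D η, .biUnion hF' hD, Set.iUnion₂_subset hDC, ?_⟩
  rintro _ ⟨y, hy, rfl⟩
  obtain ⟨η, hη, hηy⟩ := hdense y hy
  exact (hηy.map (ArcSpace.arcsMap f).continuous).mem_closed isClosed_closure
    (subset_closure (Set.mem_biUnion hη (hηD η hη)))
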